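/- Let $(\mathbb X,\mu)$ and $(\Theta,\nu)$ be $\sigma$-finite measure spaces; all functions are complex-valued, all $L^2$ spaces are complex, and $\mathbb X\times\Theta$ carries the product measure $\mu\times\nu$. A function $F\colon\mathbb X\times\Theta\to\mathbb C$ is called *finitely additively separable* (FAS) if there are $J\in\mathbb N$, functions $f_1,\dots,f_J\colon\mathbb X\to\mathbb C$ and $g_1,\dots,g_J\colon\Theta\to\mathbb C$, and constants $c_1,\dots,c_J\in\mathbb C$ with $F(x,\theta)=\sum_{j=1}^J c_j f_j(x)g_j(\theta)$ for all $(x,\theta)$. Let $\Gamma\in L^2(\mathbb X\times\Theta)$. For $N\in\{0,1,2,\dots\}\cup\{\infty\}$, an *expansion of $\Gamma$ of length $N$* consists of functions $u_j\colon\mathbb X\to\mathbb C$ and $v_j\colon\Theta\to\mathbb C$ ($1\le j\le N$, $j<\infty$) forming orthonormal systems in $L^2(\mathbb X)$ and $L^2(\Theta)$ respectively, and of real numbers $\eta_1\ge\eta_2\ge\dots\ge0$ with $\eta_j=0$ for $j>N$, such that the partial sums $$\Gamma_J(x,\theta):=\sum_{j=1}^{J}\eta_j\,\overline{u_j(x)}\,v_j(\theta)$$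 (terms with $j>N$ being zero) satisfy $\lVert\Gamma-\Gamma_J\rVert_2\to0$ as $J\to\infty$. (a) $\Gamma$ has an expansion of length $N=\min\{\dim L^2(\mathbb X),\dim L^2(\Theta)\}$, where an infinite dimension counts as $\infty$; in particular, if both spaces are infinite-dimensional, $(u_j)_{j\ge1}$ and $(v_j)_{j\ge1}$ are infinite orthonormal sequences. (b) For every expansion of $\Gamma$, of any length, and every $J\ge0$, the partial sum $\Gamma_J$ is an FAS function in $L^2(\mathbb X\times\Theta)$, and $$\lVert\Gamma-\Gamma_J\rVert_2^2=\lVert\Gamma\rVert_2^2-\sum_{j=1}^{J}\eta_j^2 .$$ (c) If, for an expansion of $\Gamma$ of length $N$, furthermore $\sum_j\eta_j<\infty$, there is a constant $M$ with $|u_j(x)|\le M$ and $|v_j(\theta)|\le M$ for all $j\le N$, $x\in\mathbb X$ and $\theta\in\Theta$, and $\Gamma(x,\theta)=\sum_{j=1}^\infty\eta_j\,\overline{u_j(x)}\,v_j(\theta)$ for every $(x,\theta)\in\mathbb X\times\Theta$, then $\Gamma_J\to\Gamma$ uniformly on $\mathbb X\times\Theta$. -/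

import Mathlib

open MeasureTheory Filter Topology
open scoped ENNReal ComplexConjugate

/-- A finitely additively separable (FAS) function: a finite sum
`∑ j, η j * f j x * g j θ` of constants times products of functions of one variable. -/
def IsFAS {X Θ : Type*} (Γ : X × Θ → ℂ) : Prop :=
  ∃ (J : ℕ) (f : Fin J → X → ℂ) (g : Fin J → Θ → ℂ) (η : Fin J → ℂ),
    ∀ x θ, Γ (x, θ) = ∑ j, η j * f j x * g j θ

/-- The functions `u j`, `j < N`, are (everywhere defined representatives of) an orthonormal
system in `L²(μ)`.  Here `N` is a natural number or `⊤`; for `N = ⊤` the system is an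
infinite sequence.  Nothing is said about `u j` for `j ≥ N`. -/
def IsOrthonormalSystem {X : Type*} [MeasurableSpace X] (μ : Measure X) (N : ℕ∞)
    (u : ℕ → X → ℂ) : Prop :=
  ∃ h : ∀ j : {j : ℕ // (j : ℕ∞) < N}, MemLp (u j) 2 μ,
    Orthonormal ℂ (fun j : {j : ℕ // (j : ℕ∞) < N} => (h j).toLp (u j))

/-- Two orthonormal systems of length `N` in `L²(μ)` and `L²(ν)`, with non-negative
non-increasing coefficients `η`, which vanish beyond the length of the systems.
Indices start at `0`. -/
structure IsSchmidtSystem {X Θ : Type*} [MeasurableSpace X] [MeasurableSpace Θ]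
    (μ : Measure X) (ν : Measure Θ) (N : ℕ∞)
    (η : ℕ → ℝ) (u : ℕ → X → ℂ) (v : ℕ → Θ → ℂ) : Prop where
  orthonormal_left : IsOrthonormalSystem μ N u
  orthonormal_right : IsOrthonormalSystem ν N v
  nonneg : ∀ j, 0 ≤ η j
  antitone : Antitone η
  eq_zero : ∀ j : ℕ, N ≤ (j : ℕ∞) → η j = 0

/-- The partial sum of the first `J` terms of `∑ j, η j * conj (u j x) * v j θ`. -/
noncomputable def schmidtPartialSum {X Θ : Type*} (η : ℕ → ℝ) (u : ℕ → X → ℂ)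
    (v : ℕ → Θ → ℂ) (J : ℕ) : X × Θ → ℂ :=
  fun p => ∑ j ∈ Finset.range J, (η j : ℂ) * conj (u j p.1) * v j p.2

/-- The dimension of the complex space `L²(μ)`, equal to `⊤` if it is infinite. -/
noncomputable def dimL2 {X : Type*} [MeasurableSpace X] (μ : Measure X) : ℕ∞ :=
  Cardinal.toENat (Module.rank ℂ (Lp ℂ 2 μ))

/-! Read `Γ` as the kernel of the operator `T a = ∫ a(x) Γ(x, ·) dμ(x)` from `L²(μ)` to `L²(ν)`.
Products `conj a * b` give rank-one operators and are total in `L²(μ.prod ν)`, so `T` is a norm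
limit of finite-rank operators, hence compact. A greedy choice of singular pairs, each on the
orthogonal complements of the earlier ones, yields `η`, `u`, `v` with `‖T a‖ ≤ η n * ‖a‖` off the
first `n` vectors. Unit vectors are still chosen when `η n = 0`, so the systems stop only when one
of the spaces is exhausted. The terms `η j • t (u j) (v j)` are orthogonal and pair with `Γ` to `η j
^ 2`. Bessel makes `η` square-summable, so `η → 0` and the series converges to some `Γ'`. The
operator of the `J`-th remainder is bounded by `η J`, so `Γ - Γ'` has zero operator, and totality
gives `Γ = Γ'` (`exists_schmidt_expansion`). For an arbitrary expansion, the error formula is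
Pythagoras, and uniform convergence is the Weierstrass test. -/

namespace SchmidtExpansion

/-! ### Singular values of compact operators -/

section Hilbert

open ContinuousLinearMap Submodule
open scoped InnerProductSpace

variable {E F H : Type*}
  [NormedAddCommGroup E] [InnerProductSpace ℂ E] [CompleteSpace E]
  [NormedAddCommGroup F] [InnerProductSpace ℂ F] [CompleteSpace F]
  [NormedAddCommGroup H] [InnerProductSpace ℂ H] [CompleteSpace H]

/-- The operator norm of a compact operator is attained at an eigenvector of `T† T`. -/
theorem exists_norm_eigenvector [Nontrivial E] (T : E →L[ℂ] F) (hT : IsCompactOperator T) :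
    ∃ u : E, ‖u‖ = 1 ∧ adjoint T (T u) = ((‖T‖ : ℂ) ^ 2) • u := by
  rcases eq_or_ne T 0 with rfl | hT0
  · obtain ⟨u, hu⟩ := exists_norm_eq E zero_le_one
    exact ⟨u, hu, by simp⟩
  have hnT : ‖T‖ ≠ 0 := norm_ne_zero_iff.2 hT0
  set S : E →L[ℂ] E := adjoint T ∘L T with hS
  have hSc : IsCompactOperator S := hT.clm_comp (adjoint T)
  have hSsa : IsSelfAdjoint S := by
    rw [ContinuousLinearMap.isSelfAdjoint_iff', hS, adjoint_comp, adjoint_adjoint]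
  obtain ⟨z, hz, hzn⟩ := spectrum.exists_nnnorm_eq_spectralRadius S
  rw [S.spectralRadius_eq_nnnorm hSsa, ENNReal.coe_inj] at hzn
  have hzn' : ‖z‖ = ‖T‖ * ‖T‖ := by
    rw [← norm_adjoint_comp_self]; exact congrArg NNReal.toReal hzn
  have hz0 : z ≠ 0 := by
    rw [← norm_ne_zero_iff, hzn']; positivity
  obtain ⟨w, hw⟩ := ((hSc.hasEigenvalue_iff_mem_spectrum hz0).2 hz).exists_hasEigenvector
  have hw0 : ‖w‖ ≠ 0 := norm_ne_zero_iff.2 hw.2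
  have hSw : adjoint T (T w) = z • w := hw.apply_eq_smul
  -- The eigenvalue is a Rayleigh quotient, so it is real and nonnegative and its modulus determines
  -- it.
  have hzz : z = (‖T‖ : ℂ) ^ 2 := by
    have h1 : ⟪w, adjoint T (T w)⟫_ℂ = ((‖T w‖ : ℂ)) ^ 2 := by
      rw [adjoint_inner_right, inner_self_eq_norm_sq_to_K]; rfl
    rw [hSw, inner_smul_right, inner_self_eq_norm_sq_to_K] at h1
    have h2 : z = ((‖T w‖ ^ 2 / ‖w‖ ^ 2 : ℝ) : ℂ) := by
      push_cast
      rw [eq_div_iff (by simpa using hw0)]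
      exact h1
    rw [h2, Complex.norm_real, Real.norm_of_nonneg (by positivity)] at hzn'
    rw [h2, hzn']; push_cast; ring
  refine ⟨((‖w‖ : ℂ)⁻¹) • w, ?_, ?_⟩
  · rw [norm_smul, norm_inv, Complex.norm_real, norm_norm, inv_mul_cancel₀ hw0]
  · rw [map_smul, map_smul, hSw, ← hzz, smul_comm]

/-- A compact operator has a pair of unit singular vectors for its norm. -/
theorem exists_singular_pair [Nontrivial E] [Nontrivial F] (T : E →L[ℂ] F)
    (hT : IsCompactOperator T) :
    ∃ (u : E) (v : F), ‖u‖ = 1 ∧ ‖v‖ = 1 ∧ T u = (‖T‖ : ℂ) • v ∧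
      adjoint T v = (‖T‖ : ℂ) • u := by
  obtain ⟨u, hu, hTu⟩ := exists_norm_eigenvector T hT
  rcases eq_or_ne T 0 with rfl | hT0
  · obtain ⟨v, hv⟩ := exists_norm_eq F zero_le_one
    exact ⟨u, v, hu, hv, by simp⟩
  have hnT : ‖T‖ ≠ 0 := norm_ne_zero_iff.2 hT0
  have hnC : (‖T‖ : ℂ) ≠ 0 := by exact_mod_cast hnT
  have hn : ‖T u‖ = ‖T‖ := by
    have h1 : ⟪u, adjoint T (T u)⟫_ℂ = ((‖T u‖ : ℂ)) ^ 2 := by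
      rw [adjoint_inner_right, inner_self_eq_norm_sq_to_K]; rfl
    rw [hTu, inner_smul_right, inner_self_eq_norm_sq_to_K, hu] at h1
    have h2 : ‖T‖ ^ 2 = ‖T u‖ ^ 2 := by
      have : (‖T‖ : ℂ) ^ 2 = (‖T u‖ : ℂ) ^ 2 := by simpa using h1
      exact_mod_cast this
    exact ((pow_left_inj₀ (norm_nonneg _) (norm_nonneg _) two_ne_zero).1 h2).symm
  refine ⟨u, (‖T‖ : ℂ)⁻¹ • T u, hu, ?_, ?_, ?_⟩
  · rw [norm_smul, norm_inv, Complex.norm_real, norm_norm, hn, inv_mul_cancel₀ hnT]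
  · rw [smul_smul, mul_inv_cancel₀ hnC, one_smul]
  · rw [map_smul, hTu, smul_smul, pow_two, inv_mul_cancel_left₀ hnC]

/-- A singular pair of `T` in the orthogonal complements of `U` and `V`. -/
theorem exists_singular_pair_orthogonal (T : E →L[ℂ] F) (hT : IsCompactOperator T)
    (U : Submodule ℂ E) (V : Submodule ℂ F)
    (hUV : ∀ a ∈ Uᗮ, T a ∈ Vᗮ) (hVU : ∀ b ∈ Vᗮ, adjoint T b ∈ Uᗮ) :
    ∃ (η : ℝ) (u : E) (v : F), 0 ≤ η ∧ u ∈ Uᗮ ∧ v ∈ Vᗮ ∧ T u = (η : ℂ) • v ∧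
      adjoint T v = (η : ℂ) • u ∧ (Uᗮ ≠ ⊥ → Vᗮ ≠ ⊥ → ‖u‖ = 1 ∧ ‖v‖ = 1) ∧
      (Uᗮ = ⊥ ∨ Vᗮ = ⊥ → η = 0 ∧ u = 0 ∧ v = 0) ∧ ∀ a ∈ Uᗮ, ‖T a‖ ≤ η * ‖a‖ := by
  by_cases h : Uᗮ = ⊥ ∨ Vᗮ = ⊥
  -- No unit pair is left here; zero values let the recursion continue indefinitely.
  · refine ⟨0, 0, 0, le_rfl, zero_mem _, zero_mem _, by simp, by simp, by tauto, by simp, ?_⟩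
    intro a ha
    rcases h with h | h
    · rw [h, Submodule.mem_bot] at ha; simp [ha]
    · have := hUV a ha
      rw [h, Submodule.mem_bot] at this; simp [this]
  push Not at h
  have : Nontrivial Uᗮ := Submodule.nontrivial_iff_ne_bot.2 h.1
  have : Nontrivial Vᗮ := Submodule.nontrivial_iff_ne_bot.2 h.2
  let S : Uᗮ →L[ℂ] Vᗮ := (T ∘L Uᗮ.subtypeL).codRestrict Vᗮ fun a => hUV a a.2
  have hSa : ∀ a : Uᗮ, ((S a : Vᗮ) : F) = T a := fun a => rfl
  have hS : IsCompactOperator S :=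
    (hT.comp_clm Uᗮ.subtypeL).codRestrict (fun a => hUV a a.2) (isClosed_orthogonal V)
  have hSadj : ∀ b : Vᗮ, ((adjoint S b : Uᗮ) : E) = adjoint T b := by
    intro b
    have : adjoint S b = ⟨adjoint T b, hVU b b.2⟩ := by
      refine ext_inner_right ℂ fun a => ?_
      rw [adjoint_inner_left, Submodule.coe_inner, Submodule.coe_inner, hSa, adjoint_inner_left]
    rw [this]
  obtain ⟨u, v, hu, hv, h1, h2⟩ := exists_singular_pair S hS
  refine ⟨‖S‖, u, v, norm_nonneg S, u.2, v.2, ?_, ?_, fun _ _ => ⟨hu, hv⟩, by tauto, ?_⟩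
  · rw [← hSa, h1]; rfl
  · rw [← hSadj, h2]; rfl
  · intro a ha
    exact S.le_opNorm ⟨a, ha⟩

/-- **Singular value decomposition** of a compact operator. -/
theorem exists_singular_sequence (T : E →L[ℂ] F) (hT : IsCompactOperator T) :
    ∃ (η : ℕ → ℝ) (u : ℕ → E) (v : ℕ → F) (U : ℕ → Submodule ℂ E) (V : ℕ → Submodule ℂ F),
      (∀ n, U n = span ℂ (u '' Set.Iio n)) ∧ (∀ n, V n = span ℂ (v '' Set.Iio n)) ∧
      ∀ n, 0 ≤ η n ∧ u n ∈ (U n)ᗮ ∧ v n ∈ (V n)ᗮ ∧ T (u n) = (η n : ℂ) • v n ∧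
        ((U n)ᗮ ≠ ⊥ → (V n)ᗮ ≠ ⊥ → ‖u n‖ = 1 ∧ ‖v n‖ = 1) ∧
        ((U n)ᗮ = ⊥ ∨ (V n)ᗮ = ⊥ → η n = 0 ∧ u n = 0 ∧ v n = 0) ∧
        ∀ a ∈ (U n)ᗮ, ‖T a‖ ≤ η n * ‖a‖ := by
  -- The state carries the invariance of the complements under `T` and its adjoint; the singular
  -- relations preserve it when a pair is adjoined.
  let St := {p : Submodule ℂ E × Submodule ℂ F //
    (∀ a ∈ p.1ᗮ, T a ∈ p.2ᗮ) ∧ ∀ b ∈ p.2ᗮ, adjoint T b ∈ p.1ᗮ}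
  choose η u v h0 hu hv hTu hTv hn hz hb using fun s : St =>
    exists_singular_pair_orthogonal T hT s.1.1 s.1.2 s.2.1 s.2.2
  let next : St → St := fun s =>
    ⟨(s.1.1 ⊔ span ℂ {u s}, s.1.2 ⊔ span ℂ {v s}), by
      constructor
      · intro a ha
        rw [← Submodule.inf_orthogonal, Submodule.mem_inf, mem_orthogonal_singleton_iff_inner_right]
          at ha ⊢
        refine ⟨s.2.1 a ha.1, ?_⟩
        rw [← adjoint_inner_left, hTv, inner_smul_left, ha.2, mul_zero]
      · intro b hb
        rw [← Submodule.inf_orthogonal, Submodule.mem_inf, mem_orthogonal_singleton_iff_inner_right]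
          at hb ⊢
        refine ⟨s.2.2 b hb.1, ?_⟩
        rw [adjoint_inner_right, hTu, inner_smul_left, hb.2, mul_zero]⟩
  let st : ℕ → St := fun n => Nat.rec ⟨(⊥, ⊥), by simp⟩ (fun _ s => next s) n
  have hst : ∀ n, st (n + 1) = next (st n) := fun n => rfl
  have hIio : ∀ n : ℕ, Set.Iio (n + 1) = insert n (Set.Iio n) := fun n => by
    ext; simp
  refine ⟨fun n => η (st n), fun n => u (st n), fun n => v (st n), fun n => (st n).1.1,
    fun n => (st n).1.2, ?_, ?_, fun n => ⟨h0 _, hu _, hv _, hTu _, hn _, hz _, hb _⟩⟩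
  · intro n
    induction n with
    | zero => simp [st]
    | succ n ih =>
      rw [hIio, Set.image_insert_eq, span_insert, ← ih, sup_comm]
  · intro n
    induction n with
    | zero => simp [st]
    | succ n ih =>
      rw [hIio, Set.image_insert_eq, span_insert, ← ih, sup_comm]

end Hilbert

/-! ### Expansions in an abstract Hilbert tensor product -/

section Tensor

open ContinuousLinearMap Submodule
open scoped InnerProductSpace

variable {E F H : Type*}
  [NormedAddCommGroup E] [InnerProductSpace ℂ E]
  [NormedAddCommGroup F] [InnerProductSpace ℂ F]
  [NormedAddCommGroup H] [InnerProductSpace ℂ H]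

/-- A finite-dimensional span is complete, so a trivial complement would make it the whole space and
force the dimension to be at most `n`. -/
theorem orthogonal_span_image_Iio_ne_bot (u : ℕ → E) {n : ℕ}
    (hn : (n : ℕ∞) < Cardinal.toENat (Module.rank ℂ E)) :
    (span ℂ (u '' Set.Iio n))ᗮ ≠ ⊥ := by
  have : FiniteDimensional ℂ (span ℂ (u '' Set.Iio n)) :=
    FiniteDimensional.span_of_finite ℂ ((Set.finite_Iio n).image u)
  rw [Ne, Submodule.orthogonal_eq_bot_iff]
  intro h
  refine absurd hn (not_lt.2 ?_)
  rw [Cardinal.toENat_le_natCast, ← rank_top, ← h]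
  refine (rank_span_le _).trans ?_
  have h1 := Cardinal.mk_image_le_lift (f := u) (s := Set.Iio n)
  simpa using h1

theorem orthogonal_span_image_Iio_eq_bot (u : ℕ → E) {n : ℕ}
    (hn : Cardinal.toENat (Module.rank ℂ E) = n)
    (hu : Orthonormal ℂ fun i : Set.Iio n => u i) :
    (span ℂ (u '' Set.Iio n))ᗮ = ⊥ := by
  have hr : Module.rank ℂ E = n := by simpa using hn
  have : FiniteDimensional ℂ E := Module.rank_lt_aleph0_iff.1 (by simp [hr])
  have hf : Module.finrank ℂ E = n := Module.finrank_eq_of_rank_eq hr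
  have h := hu.linearIndependent.span_eq_top_of_card_eq_finrank' (by simp [hf])
  rw [Set.image_eq_range, h, Submodule.top_orthogonal_eq_bot]

/-- A series of pairwise orthogonal vectors with square-summable norms is summable. -/
theorem summable_of_pairwise_orthogonal [CompleteSpace H] {x : ℕ → H} {η : ℕ → ℝ}
    (hx : ∀ i j, ⟪x i, x j⟫_ℂ = if i = j then ((η j : ℂ)) ^ 2 else 0)
    (hη : Summable fun j => η j ^ 2) : Summable x := by
  have hO : OrthogonalFamily ℂ (fun j => span ℂ {x j}) fun j => (span ℂ {x j}).subtypeₗᵢ := by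
    intro i j hij a b
    obtain ⟨c, hc⟩ := Submodule.mem_span_singleton.1 a.2
    obtain ⟨d, hd⟩ := Submodule.mem_span_singleton.1 b.2
    change ⟪(a : H), (b : H)⟫_ℂ = 0
    rw [← hc, ← hd, inner_smul_left, inner_smul_right, hx, if_neg hij, mul_zero, mul_zero]
  have hn : ∀ j, ‖x j‖ ^ 2 = η j ^ 2 := by
    intro j
    have h := congrArg RCLike.re (hx j j)
    rw [inner_self_eq_norm_sq, if_pos rfl, ← Complex.ofReal_pow] at h
    exact h
  refine (hO.summable_iff_norm_sq_summable
    fun j => ⟨x j, Submodule.mem_span_singleton_self _⟩).2 ?_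
  simpa [hn] using hη

theorem norm_sub_sum_sq {x : ℕ → H} {η : ℕ → ℝ} {Γ : H}
    (hx : ∀ i j, ⟪x i, x j⟫_ℂ = if i = j then ((η j : ℂ)) ^ 2 else 0)
    (hΓ : ∀ j, ⟪x j, Γ⟫_ℂ = (η j : ℂ) ^ 2) (J : ℕ) :
    ‖Γ - ∑ j ∈ Finset.range J, x j‖ ^ 2 = ‖Γ‖ ^ 2 - ∑ j ∈ Finset.range J, η j ^ 2 := by
  have h1 : ⟪∑ j ∈ Finset.range J, x j, Γ⟫_ℂ = ((∑ j ∈ Finset.range J, η j ^ 2 : ℝ) : ℂ) := by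
    rw [sum_inner]; push_cast
    exact Finset.sum_congr rfl fun j _ => hΓ j
  have h2 : ⟪∑ j ∈ Finset.range J, x j, ∑ j ∈ Finset.range J, x j⟫_ℂ =
      ((∑ j ∈ Finset.range J, η j ^ 2 : ℝ) : ℂ) := by
    rw [sum_inner]; push_cast
    refine Finset.sum_congr rfl fun j hj => ?_
    rw [inner_sum]
    simp only [hx]
    rw [Finset.sum_ite_eq, if_pos hj]
  have h3 : ‖∑ j ∈ Finset.range J, x j‖ ^ 2 = ∑ j ∈ Finset.range J, η j ^ 2 := by
    have h := congrArg RCLike.re h2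
    rw [inner_self_eq_norm_sq] at h
    exact h
  rw [@norm_sub_sq ℂ, h3, ← inner_re_symm, h1]
  simp only [RCLike.re_to_complex, Complex.ofReal_re]
  ring

/-- By orthogonality the inner products of `x i` with the partial sums are constant from `J = i + 1`
on. This supplies the hypothesis of `norm_sub_sum_sq` for an arbitrary expansion. -/
theorem inner_eq_of_tendsto_sum {x : ℕ → H} {η : ℕ → ℝ} {Γ : H}
    (hx : ∀ i j, ⟪x i, x j⟫_ℂ = if i = j then ((η j : ℂ)) ^ 2 else 0)
    (hΓ : Tendsto (fun J => ∑ j ∈ Finset.range J, x j) atTop (𝓝 Γ)) (i : ℕ) :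
    ⟪x i, Γ⟫_ℂ = (η i : ℂ) ^ 2 := by
  have h1 := (tendsto_const_nhds (x := x i)).inner (𝕜 := ℂ) hΓ
  refine tendsto_nhds_unique h1 (tendsto_const_nhds.congr' ?_)
  filter_upwards [eventually_gt_atTop i] with J hJ
  rw [inner_sum]
  simp only [hx]
  rw [Finset.sum_ite_eq, if_pos (Finset.mem_range.2 hJ)]

variable [CompleteSpace F] [CompleteSpace H]

/-- The operator `a ↦ (t a)† x` with kernel `x`, for a sesquilinear map `t`. -/
noncomputable def kernelOperator (t : E →L⋆[ℂ] F →L[ℂ] H) : H →L[ℂ] E →L[ℂ] F :=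
  (LinearMap.mk₂ ℂ (fun x a => adjoint (t a) x)
    (by simp) (by simp) (by simp) (by intro c x a; rw [map_smulₛₗ, map_smulₛₗ]; simp)).mkContinuous₂ ‖t‖ (by
      intro x a
      simp only [LinearMap.mk₂_apply]
      refine (ContinuousLinearMap.le_opNorm _ _).trans ?_
      rw [LinearIsometryEquiv.norm_map, mul_right_comm]
      exact mul_le_mul_of_nonneg_right (t.le_opNorm a) (norm_nonneg x))

theorem inner_kernelOperator (t : E →L⋆[ℂ] F →L[ℂ] H) (x : H) (a : E) (b : F) :
    ⟪b, kernelOperator t x a⟫_ℂ = ⟪t a b, x⟫_ℂ :=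
  adjoint_inner_right (t a) b x

theorem kernelOperator_tensor {t : E →L⋆[ℂ] F →L[ℂ] H}
    (ht : ∀ a b c d, ⟪t a b, t c d⟫_ℂ = ⟪c, a⟫_ℂ * ⟪b, d⟫_ℂ) (a c : E) (d : F) :
    kernelOperator t (t c d) a = ⟪c, a⟫_ℂ • d := by
  refine ext_inner_left ℂ fun b => ?_
  rw [inner_kernelOperator, ht, inner_smul_right]

/-- The vectors with compact kernel operator form a closed subspace; it contains the tensors, whose
operators have rank at most one, and these are total. -/
theorem isCompactOperator_kernelOperator {t : E →L⋆[ℂ] F →L[ℂ] H}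
    (ht : ∀ a b c d, ⟪t a b, t c d⟫_ℂ = ⟪c, a⟫_ℂ * ⟪b, d⟫_ℂ)
    (htot : ∀ x, (∀ a b, ⟪t a b, x⟫_ℂ = 0) → x = 0) (x : H) :
    IsCompactOperator (kernelOperator t x) := by
  let K : Submodule ℂ H := (compactOperator (RingHom.id ℂ) E F).comap (kernelOperator t).toLinearMap
  have hK : IsClosed (K : Set H) :=
    (isClosed_setOfPred_isCompactOperator (σ₁₂ := RingHom.id ℂ) (M₁ := E) (M₂ := F)).preimage
      (kernelOperator t).continuous
  have htK : ∀ a b, t a b ∈ K := by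
    intro c d
    change IsCompactOperator (kernelOperator t (t c d))
    have h : (kernelOperator t (t c d)) = (toSpanSingleton ℂ d) ∘L (innerSL ℂ c) := by
      ext a
      simp [kernelOperator_tensor ht]
    rw [h]
    exact (isCompactOperator_of_locallyCompactSpace_rng (toSpanSingleton ℂ d)).comp_clm
      (innerSL ℂ c)
  have hKo : Kᗮ = ⊥ := by
    rw [Submodule.eq_bot_iff]
    intro y hy
    exact htot y fun a b => (Submodule.mem_orthogonal _ _).1 hy _ (htK a b)
  have hKt : K = ⊤ := by
    rw [← hK.submodule_topologicalClosure_eq, Submodule.topologicalClosure_eq_top_iff, hKo]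
  have : x ∈ K := hKt ▸ Submodule.mem_top
  exact this

variable [CompleteSpace E]

/-- The Schmidt expansion of an element of a Hilbert tensor product. -/
theorem exists_schmidt_expansion {t : E →L⋆[ℂ] F →L[ℂ] H}
    (ht : ∀ a b c d, ⟪t a b, t c d⟫_ℂ = ⟪c, a⟫_ℂ * ⟪b, d⟫_ℂ)
    (htot : ∀ x, (∀ a b, ⟪t a b, x⟫_ℂ = 0) → x = 0) (Γ : H) {N : ℕ∞}
    (hN : N = min (Cardinal.toENat (Module.rank ℂ E)) (Cardinal.toENat (Module.rank ℂ F))) :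
    ∃ (η : ℕ → ℝ) (u : ℕ → E) (v : ℕ → F),
      Orthonormal ℂ (fun j : {j : ℕ // (j : ℕ∞) < N} => u j) ∧
      Orthonormal ℂ (fun j : {j : ℕ // (j : ℕ∞) < N} => v j) ∧
      (∀ j, 0 ≤ η j) ∧ Antitone η ∧ (∀ j : ℕ, N ≤ j → η j = 0) ∧
      Tendsto (fun J => ∑ j ∈ Finset.range J, (η j : ℂ) • t (u j) (v j)) atTop (𝓝 Γ) := by
  set T := kernelOperator t Γ with hTdef
  obtain ⟨η, u, v, U, V, hU, hV, h⟩ :=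
    exists_singular_sequence T (isCompactOperator_kernelOperator ht htot Γ)
  choose h0 huU hvV hTu hone hzero hbound using h
  have hne : ∀ j : ℕ, (j : ℕ∞) < N → (U j)ᗮ ≠ ⊥ ∧ (V j)ᗮ ≠ ⊥ := by
    intro j hj
    rw [hN, lt_min_iff] at hj
    rw [hU, hV]
    exact ⟨orthogonal_span_image_Iio_ne_bot u hj.1, orthogonal_span_image_Iio_ne_bot v hj.2⟩
  have huone : ∀ j : ℕ, (j : ℕ∞) < N → ‖u j‖ = 1 := fun j hj =>
    (hone j (hne j hj).1 (hne j hj).2).1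
  have hvone : ∀ j : ℕ, (j : ℕ∞) < N → ‖v j‖ = 1 := fun j hj =>
    (hone j (hne j hj).1 (hne j hj).2).2
  have huu : ∀ i j, i ≠ j → ⟪u i, u j⟫_ℂ = 0 := by
    have key : ∀ i j, i < j → ⟪u i, u j⟫_ℂ = 0 := fun i j hij =>
      (Submodule.mem_orthogonal _ _).1 (huU j) _
        (by rw [hU]; exact subset_span (Set.mem_image_of_mem u hij))
    intro i j hij
    rcases hij.lt_or_gt with h | h
    · exact key i j h
    · rw [inner_eq_zero_symm]; exact key j i h
  have hvv : ∀ i j, i ≠ j → ⟪v i, v j⟫_ℂ = 0 := by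
    have key : ∀ i j, i < j → ⟪v i, v j⟫_ℂ = 0 := fun i j hij =>
      (Submodule.mem_orthogonal _ _).1 (hvV j) _
        (by rw [hV]; exact subset_span (Set.mem_image_of_mem v hij))
    intro i j hij
    rcases hij.lt_or_gt with h | h
    · exact key i j h
    · rw [inner_eq_zero_symm]; exact key j i h
  have hUmono : ∀ i j, i ≤ j → (U j)ᗮ ≤ (U i)ᗮ := by
    intro i j hij
    rw [hU, hU]
    exact Submodule.orthogonal_le (span_mono (Set.image_mono (Set.Iio_subset_Iio hij)))
  have hVmono : ∀ i j, i ≤ j → (V j)ᗮ ≤ (V i)ᗮ := by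
    intro i j hij
    rw [hV, hV]
    exact Submodule.orthogonal_le (span_mono (Set.image_mono (Set.Iio_subset_Iio hij)))
  have hbot : ∀ j : ℕ, N ≤ j → (U j)ᗮ = ⊥ ∨ (V j)ᗮ = ⊥ := by
    intro j hj
    -- Here `N` is a finite `n`, and the first `n` orthonormal vectors fill whichever space attains
    -- the minimal dimension.
    obtain ⟨n, rfl⟩ := ENat.ne_top_iff_exists.1 (ne_top_of_le_ne_top (ENat.natCast_ne_top j) hj)
    have hnj : n ≤ j := by exact_mod_cast hj
    rcases min_choice (Cardinal.toENat (Module.rank ℂ E)) (Cardinal.toENat (Module.rank ℂ F))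
      with hm | hm
    · left
      have : (U n)ᗮ = ⊥ := by
        rw [hU]
        refine orthogonal_span_image_Iio_eq_bot u (hm.symm.trans hN.symm)
          ⟨fun i => huone i (by exact_mod_cast i.2), fun i k hik => huu i k ?_⟩
        exact fun h => hik (Subtype.ext h)
      exact le_bot_iff.1 (this ▸ hUmono n j hnj)
    · right
      have : (V n)ᗮ = ⊥ := by
        rw [hV]
        refine orthogonal_span_image_Iio_eq_bot v (hm.symm.trans hN.symm)
          ⟨fun i => hvone i (by exact_mod_cast i.2), fun i k hik => hvv i k ?_⟩
        exact fun h => hik (Subtype.ext h)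
      exact le_bot_iff.1 (this ▸ hVmono n j hnj)
  have hηzero : ∀ j : ℕ, N ≤ j → η j = 0 := fun j hj => (hzero j (hbot j hj)).1
  have hanti : Antitone η := by
    refine antitone_nat_of_succ_le fun j => ?_
    rcases lt_or_ge ((j + 1 : ℕ) : ℕ∞) N with hj | hj
    -- The next vector competes in the earlier maximisation, since the complements decrease.
    · have h1 := hbound j (u (j + 1)) (hUmono j (j + 1) (Nat.le_succ j) (huU _))
      rwa [hTu, norm_smul, hvone _ hj, huone _ hj, mul_one, mul_one, Complex.norm_real,
        Real.norm_of_nonneg (h0 _)] at h1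
    · rw [hηzero _ hj]; exact h0 j
  set x : ℕ → H := fun j => (η j : ℂ) • t (u j) (v j) with hxdef
  have hx : ∀ i j, ⟪x i, x j⟫_ℂ = if i = j then ((η j : ℂ)) ^ 2 else 0 := by
    intro i j
    rw [hxdef]
    simp only [inner_smul_left, inner_smul_right, ht]
    split_ifs with hij
    · subst hij
      rcases lt_or_ge (i : ℕ∞) N with hj | hj
      · rw [inner_self_eq_norm_sq_to_K, inner_self_eq_norm_sq_to_K, huone i hj, hvone i hj]
        simp [pow_two]
      · simp [hηzero i hj]
    · rw [hvv i j hij]; simp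
  have hxΓ : ∀ j, ⟪x j, Γ⟫_ℂ = (η j : ℂ) ^ 2 := by
    intro j
    rw [hxdef, inner_smul_left, ← inner_kernelOperator, ← hTdef, hTu, inner_smul_right]
    rcases lt_or_ge (j : ℕ∞) N with hj | hj
    · rw [inner_self_eq_norm_sq_to_K, hvone j hj]
      simp [pow_two]
    · simp [hηzero j hj]
  have hsq : Summable fun j => η j ^ 2 := by
    refine summable_of_sum_range_le (c := ‖Γ‖ ^ 2) (fun j => sq_nonneg _) fun J => ?_
    have := norm_sub_sum_sq hx hxΓ J
    nlinarith [sq_nonneg ‖Γ - ∑ j ∈ Finset.range J, x j‖]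
  have hηlim : Tendsto η atTop (𝓝 0) := by
    have := hsq.tendsto_atTop_zero.sqrt
    simpa [Real.sqrt_sq (h0 _)] using this
  obtain ⟨Γ', hΓ'⟩ := summable_of_pairwise_orthogonal hx hsq
  have hlim := hΓ'.tendsto_sum_nat
  -- The remainder's operator vanishes on `U J` and agrees with `T` on the complement, where
  -- `hbound` applies.
  have hkill : ∀ J a, ‖kernelOperator t (Γ - ∑ j ∈ Finset.range J, x j) a‖ ≤ η J * ‖a‖ := by
    intro J a
    have hA : ∀ a, kernelOperator t (Γ - ∑ j ∈ Finset.range J, x j) a =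
        T a - ∑ j ∈ Finset.range J, (η j : ℂ) • ⟪u j, a⟫_ℂ • v j := by
      intro a
      simp [map_sub, map_sum, hxdef, kernelOperator_tensor ht, hTdef]
    have : FiniteDimensional ℂ (U J) := by
      rw [hU]; exact FiniteDimensional.span_of_finite ℂ ((Set.finite_Iio J).image u)
    obtain ⟨p, hp, w, hw, rfl⟩ := (U J).exists_add_mem_mem_orthogonal a
    have hp0 : kernelOperator t (Γ - ∑ j ∈ Finset.range J, x j) p = 0 := by
      rw [hU] at hp
      refine (span_le (p := LinearMap.ker
        (kernelOperator t (Γ - ∑ j ∈ Finset.range J, x j)).toLinearMap)).2 ?_ hp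
      rintro _ ⟨i, hi, rfl⟩
      change kernelOperator t (Γ - ∑ j ∈ Finset.range J, x j) (u i) = 0
      rw [hA, hTu, Finset.sum_eq_single_of_mem i (Finset.mem_range.2 hi)]
      · rcases lt_or_ge (i : ℕ∞) N with hj | hj
        · rw [inner_self_eq_norm_sq_to_K, huone i hj]; simp
        · simp [hηzero i hj]
      · intro k _ hki
        rw [huu k i hki]; simp
    have hw0 : kernelOperator t (Γ - ∑ j ∈ Finset.range J, x j) w = T w := by
      rw [hA, Finset.sum_eq_zero, sub_zero]
      intro j hj
      rw [(Submodule.mem_orthogonal _ _).1 hw (u j)]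
      · simp
      · rw [hU]; exact subset_span (Set.mem_image_of_mem u (Finset.mem_range.1 hj))
    rw [map_add, hp0, zero_add, hw0]
    refine (hbound J w hw).trans (mul_le_mul_of_nonneg_left ?_ (h0 J))
    have hpw : ⟪p, w⟫_ℂ = 0 := (Submodule.mem_orthogonal _ _).1 hw p hp
    have := norm_add_sq_eq_norm_sq_add_norm_sq_of_inner_eq_zero p w hpw
    nlinarith [norm_nonneg w, norm_nonneg (p + w), mul_self_nonneg ‖p‖]
  have hΓΓ' : Γ - Γ' = 0 := by
    refine htot _ fun a b => ?_
    rw [← inner_kernelOperator]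
    have h1 : Tendsto (fun J => kernelOperator t (Γ - ∑ j ∈ Finset.range J, x j) a) atTop
        (𝓝 (kernelOperator t (Γ - Γ') a)) :=
      ((ContinuousLinearMap.apply ℂ F a).continuous.comp (kernelOperator t).continuous).continuousAt
        |>.tendsto.comp (tendsto_const_nhds.sub hlim)
    have h2 : Tendsto (fun J => kernelOperator t (Γ - ∑ j ∈ Finset.range J, x j) a) atTop
        (𝓝 0) :=
      squeeze_zero_norm (fun J => hkill J a) (by simpa using hηlim.mul_const ‖a‖)
    rw [tendsto_nhds_unique h1 h2, inner_zero_right]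
  refine ⟨η, u, v, ⟨fun j => huone j j.2, fun i j hij => huu i j ?_⟩,
    ⟨fun j => hvone j j.2, fun i j hij => hvv i j ?_⟩, h0, hanti, hηzero, ?_⟩
  · exact fun h => hij (Subtype.ext h)
  · exact fun h => hij (Subtype.ext h)
  · rw [sub_eq_zero.1 hΓΓ']
    exact hlim

end Tensor

/-! ### The tensor structure of `L²` of a product measure -/

section L2

open scoped InnerProductSpace

variable {X Θ : Type*} [MeasurableSpace X] [MeasurableSpace Θ]
  {μ : Measure X} {ν : Measure Θ}

theorem exists_eq_toLp (a : Lp ℂ 2 μ) : ∃ (f : X → ℂ) (hf : MemLp f 2 μ), a = hf.toLp f :=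
  ⟨a, Lp.memLp a, (Lp.toLp_coeFn a (Lp.memLp a)).symm⟩

theorem inner_toLp {f g : X → ℂ} (hf : MemLp f 2 μ) (hg : MemLp g 2 μ) :
    ⟪hf.toLp f, hg.toLp g⟫_ℂ = ∫ x, conj (f x) * g x ∂μ := by
  rw [L2.inner_def]
  refine integral_congr_ae ?_
  filter_upwards [hf.coeFn_toLp, hg.coeFn_toLp] with x h1 h2
  rw [h1, h2, RCLike.inner_apply, mul_comm]

/-- An integrable function on a finite product whose integrals over all rectangles vanish is zero
almost everywhere. -/
theorem ae_eq_zero_of_forall_setIntegral_prod_eq_zero [IsFiniteMeasure μ] [IsFiniteMeasure ν]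
    {f : X × Θ → ℂ} (hf : Integrable f (μ.prod ν))
    (h : ∀ s t, MeasurableSet s → MeasurableSet t → ∫ p in s ×ˢ t, f p ∂(μ.prod ν) = 0) :
    f =ᵐ[μ.prod ν] 0 := by
  have huniv : ∫ p, f p ∂(μ.prod ν) = 0 := by
    simpa using h Set.univ Set.univ .univ .univ
  -- Rectangles form a π-system generating the product σ-algebra.
  have key : ∀ A, MeasurableSet A → ∫ p in A, f p ∂(μ.prod ν) = 0 := by
    intro A hA
    induction A, hA using
      MeasurableSpace.induction_on_inter generateFrom_prod.symm isPiSystem_prod with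
    | empty => simp
    | basic A hA =>
      obtain ⟨s, hs, t, ht, rfl⟩ := hA
      exact h s t hs ht
    | compl A hA ih =>
      rw [setIntegral_compl hA hf, ih, huniv, sub_zero]
    | iUnion A hd hA ih =>
      rw [integral_iUnion hA hd hf.integrableOn]
      simp [ih]
  exact hf.ae_eq_zero_of_forall_setIntegral_eq_zero fun A hA _ => key A hA

theorem memLp_conj_mul [SFinite ν] {f : X → ℂ} {g : Θ → ℂ} (hf : MemLp f 2 μ) (hg : MemLp g 2 ν) :
    MemLp (fun p : X × Θ => conj (f p.1) * g p.2) 2 (μ.prod ν) := by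
  have hm : AEStronglyMeasurable (fun p : X × Θ => conj (f p.1) * g p.2) (μ.prod ν) :=
    (Complex.continuous_conj.comp_aestronglyMeasurable hf.1.comp_fst).mul hg.1.comp_snd
  rw [memLp_two_iff_integrable_sq_norm hm]
  have h := ((memLp_two_iff_integrable_sq_norm hf.1).1 hf).mul_prod
    ((memLp_two_iff_integrable_sq_norm hg.1).1 hg)
  simpa [mul_pow] using h

/-- The class of `conj (a x) * b θ` in `L²` of the product measure. -/
noncomputable def tensor [SFinite ν] (a : Lp ℂ 2 μ) (b : Lp ℂ 2 ν) : Lp ℂ 2 (μ.prod ν) :=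
  (memLp_conj_mul (Lp.memLp a) (Lp.memLp b)).toLp _

theorem tensor_toLp [SFinite ν] {f : X → ℂ} {g : Θ → ℂ} (hf : MemLp f 2 μ) (hg : MemLp g 2 ν) :
    tensor (hf.toLp f) (hg.toLp g) = (memLp_conj_mul hf hg).toLp _ := by
  rw [tensor, MemLp.toLp_eq_toLp_iff]
  have h1 := Measure.quasiMeasurePreserving_fst (μ := μ) (ν := ν) |>.ae_eq hf.coeFn_toLp
  have h2 := Measure.quasiMeasurePreserving_snd (μ := μ) (ν := ν) |>.ae_eq hg.coeFn_toLp
  filter_upwards [h1, h2] with p hp1 hp2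
  simp only [Function.comp_apply] at hp1 hp2
  rw [hp1, hp2]

variable [SigmaFinite μ] [SigmaFinite ν]

theorem inner_tensor (a : Lp ℂ 2 μ) (b : Lp ℂ 2 ν) (c : Lp ℂ 2 μ) (d : Lp ℂ 2 ν) :
    ⟪tensor a b, tensor c d⟫_ℂ = ⟪c, a⟫_ℂ * ⟪b, d⟫_ℂ := by
  obtain ⟨f, hf, rfl⟩ := exists_eq_toLp a
  obtain ⟨g, hg, rfl⟩ := exists_eq_toLp b
  obtain ⟨f', hf', rfl⟩ := exists_eq_toLp c
  obtain ⟨g', hg', rfl⟩ := exists_eq_toLp d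
  rw [tensor_toLp, tensor_toLp, inner_toLp, inner_toLp, inner_toLp, ← integral_prod_mul]
  refine integral_congr_ae (Eventually.of_forall fun p => ?_)
  simp only [map_mul, Complex.conj_conj]
  ring

theorem norm_tensor (a : Lp ℂ 2 μ) (b : Lp ℂ 2 ν) : ‖tensor a b‖ = ‖a‖ * ‖b‖ := by
  have h := inner_tensor a b a b
  simp only [inner_self_eq_norm_sq_to_K] at h
  have h' : ‖tensor a b‖ ^ 2 = (‖a‖ * ‖b‖) ^ 2 := by
    rw [mul_pow]
    have h2 : ((‖tensor a b‖ ^ 2 : ℝ) : ℂ) = ((‖a‖ ^ 2 * ‖b‖ ^ 2 : ℝ) : ℂ) := by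
      push_cast; exact h
    exact Complex.ofReal_injective h2
  exact (pow_left_inj₀ (norm_nonneg _) (by positivity) two_ne_zero).1 h'

/-- `tensor` as a continuous sesquilinear map. -/
noncomputable def tensorL (μ : Measure X) (ν : Measure Θ) [SigmaFinite μ] [SigmaFinite ν] :
    Lp ℂ 2 μ →L⋆[ℂ] Lp ℂ 2 ν →L[ℂ] Lp ℂ 2 (μ.prod ν) :=
  (LinearMap.mk₂'ₛₗ (starRingEnd ℂ) (RingHom.id ℂ) tensor
    (by
      intro a a' b
      obtain ⟨f, hf, rfl⟩ := exists_eq_toLp a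
      obtain ⟨f', hf', rfl⟩ := exists_eq_toLp a'
      obtain ⟨g, hg, rfl⟩ := exists_eq_toLp b
      rw [← MemLp.toLp_add, tensor_toLp, tensor_toLp, tensor_toLp, ← MemLp.toLp_add]
      congr 1
      ext p
      simp [add_mul])
    (by
      intro c a b
      obtain ⟨f, hf, rfl⟩ := exists_eq_toLp a
      obtain ⟨g, hg, rfl⟩ := exists_eq_toLp b
      rw [← MemLp.toLp_const_smul, tensor_toLp, tensor_toLp, ← MemLp.toLp_const_smul]
      congr 1
      ext p
      simp [mul_assoc])
    (by
      intro a b b'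
      obtain ⟨f, hf, rfl⟩ := exists_eq_toLp a
      obtain ⟨g, hg, rfl⟩ := exists_eq_toLp b
      obtain ⟨g', hg', rfl⟩ := exists_eq_toLp b'
      rw [← MemLp.toLp_add, tensor_toLp, tensor_toLp, tensor_toLp, ← MemLp.toLp_add]
      congr 1
      ext p
      simp [mul_add])
    (by
      intro c a b
      obtain ⟨f, hf, rfl⟩ := exists_eq_toLp a
      obtain ⟨g, hg, rfl⟩ := exists_eq_toLp b
      rw [← MemLp.toLp_const_smul, tensor_toLp, tensor_toLp, RingHom.id_apply,
        ← MemLp.toLp_const_smul]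
      congr 1
      ext p
      simp [mul_left_comm])).mkContinuous₂ 1 fun a b => by
        rw [one_mul]; exact (norm_tensor a b).le

theorem tensorL_apply (a : Lp ℂ 2 μ) (b : Lp ℂ 2 ν) : tensorL μ ν a b = tensor a b := rfl

/-- Testing against tensors of indicators kills the integrals over finite-measure rectangles.
Spanning sets localise to finite measure, where `L²` functions are integrable, and countably many
such rectangles cover the product. -/
theorem eq_zero_of_inner_tensor_eq_zero (x : Lp ℂ 2 (μ.prod ν))
    (hx : ∀ a b, ⟪tensor a b, x⟫_ℂ = 0) : x = 0 := by
  rw [Lp.eq_zero_iff_ae_eq_zero]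
  have hloc : ∀ m n : ℕ, x =ᵐ[(μ.prod ν).restrict (spanningSets μ m ×ˢ spanningSets ν n)] 0 := by
    intro m n
    have hm := measure_spanningSets_lt_top μ m
    have hn := measure_spanningSets_lt_top ν n
    have : IsFiniteMeasure (μ.restrict (spanningSets μ m)) := ⟨by simpa using hm⟩
    have : IsFiniteMeasure (ν.restrict (spanningSets ν n)) := ⟨by simpa using hn⟩
    rw [← Measure.prod_restrict]
    refine ae_eq_zero_of_forall_setIntegral_prod_eq_zero ?_ fun s t hs ht => ?_
    · have := ((Lp.memLp x).restrict (spanningSets μ m ×ˢ spanningSets ν n))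
      rw [← Measure.prod_restrict] at this
      exact this.integrable one_le_two
    · rw [Measure.prod_restrict, Measure.restrict_restrict (hs.prod ht), Set.prod_inter_prod]
      have hs' := hs.inter (measurableSet_spanningSets μ m)
      have ht' := ht.inter (measurableSet_spanningSets ν n)
      have hμs : μ (s ∩ spanningSets μ m) ≠ ∞ :=
        (measure_mono Set.inter_subset_right |>.trans_lt hm).ne
      have hνt : ν (t ∩ spanningSets ν n) ≠ ∞ :=
        (measure_mono Set.inter_subset_right |>.trans_lt hn).ne
      have h1 := memLp_indicator_const 2 hs' (1 : ℂ) (Or.inr hμs)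
      have h2 := memLp_indicator_const 2 ht' (1 : ℂ) (Or.inr hνt)
      have h3 := hx (h1.toLp _) (h2.toLp _)
      rw [tensor_toLp, ← Lp.toLp_coeFn x (Lp.memLp x), inner_toLp] at h3
      rw [← h3, ← integral_indicator (hs'.prod ht')]
      refine integral_congr_ae (Eventually.of_forall fun p => ?_)
      by_cases hp1 : p.1 ∈ s ∩ spanningSets μ m <;> by_cases hp2 : p.2 ∈ t ∩ spanningSets ν n <;>
        simp only [Set.indicator, Set.mem_prod, hp1, hp2] <;> simp
  have hcover : (⋃ q : ℕ × ℕ, spanningSets μ q.1 ×ˢ spanningSets ν q.2) = Set.univ := by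
    refine Set.eq_univ_of_forall fun p => Set.mem_iUnion.2 ⟨(spanningSetsIndex μ p.1,
      spanningSetsIndex ν p.2), mem_spanningSetsIndex μ p.1, mem_spanningSetsIndex ν p.2⟩
  have hall := (ae_restrict_iUnion_iff (μ := μ.prod ν)
    (fun q : ℕ × ℕ => spanningSets μ q.1 ×ˢ spanningSets ν q.2) (fun p => x p = 0)).2
    fun q => hloc q.1 q.2
  rwa [hcover, Measure.restrict_univ] at hall

end L2

/-! ### Partial sums as functions and as `L²` classes -/

open scoped InnerProductSpace

variable {X Θ : Type*}

theorem isFAS_schmidtPartialSum (η : ℕ → ℝ) (u : ℕ → X → ℂ) (v : ℕ → Θ → ℂ) (J : ℕ) :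
    IsFAS (schmidtPartialSum η u v J) :=
  ⟨J, fun j x => conj (u j x), fun j => v j, fun j => η j, fun x θ =>
    (Fin.sum_univ_eq_sum_range (fun j => (η j : ℂ) * conj (u j x) * v j θ) J).symm⟩

variable {N : ℕ∞} {η : ℕ → ℝ} {u : ℕ → X → ℂ} {v : ℕ → Θ → ℂ}

/-- The Weierstrass test for a bounded Schmidt system. -/
theorem tendstoUniformly_schmidtPartialSum (hη0 : ∀ j, 0 ≤ η j)
    (hηN : ∀ j : ℕ, N ≤ (j : ℕ∞) → η j = 0) (hη : Summable η) {M : ℝ}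
    (hM : ∀ j : ℕ, (j : ℕ∞) < N → (∀ x, ‖u j x‖ ≤ M) ∧ (∀ θ, ‖v j θ‖ ≤ M)) {Γ : X × Θ → ℂ}
    (hΓ : ∀ p, Tendsto (fun J => schmidtPartialSum η u v J p) atTop (𝓝 (Γ p))) :
    TendstoUniformly (schmidtPartialSum η u v) Γ atTop := by
  have h := tendstoUniformly_tsum_nat (hη.mul_right (M * M))
    (f := fun j (p : X × Θ) => (η j : ℂ) * conj (u j p.1) * v j p.2) fun j p => by
      rcases lt_or_ge (j : ℕ∞) N with hj | hj
      · rw [mul_assoc, norm_mul, norm_mul, Complex.norm_real, Real.norm_of_nonneg (hη0 j),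
          Complex.norm_conj]
        have h1 := (hM j hj).1 p.1
        exact mul_le_mul_of_nonneg_left (mul_le_mul h1 ((hM j hj).2 p.2) (norm_nonneg _)
          ((norm_nonneg _).trans h1)) (hη0 j)
      · simp [hηN j hj]
  have hlim : (fun p : X × Θ => ∑' j, (η j : ℂ) * conj (u j p.1) * v j p.2) = Γ :=
    funext fun p => tendsto_nhds_unique (h.tendsto_at p) (hΓ p)
  rwa [hlim] at h

variable [MeasurableSpace X] [MeasurableSpace Θ] {μ : Measure X} {ν : Measure Θ}

theorem toLp_schmidtPartialSum
    (hm : ∀ j, MemLp (fun p : X × Θ => (η j : ℂ) * conj (u j p.1) * v j p.2) 2 (μ.prod ν))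
    (J : ℕ) : ∃ hJ : MemLp (schmidtPartialSum η u v J) 2 (μ.prod ν),
      hJ.toLp _ = ∑ j ∈ Finset.range J, (hm j).toLp _ := by
  induction J with
  | zero =>
    have h0 : schmidtPartialSum η u v 0 = (0 : X × Θ → ℂ) := by
      funext p
      simp [schmidtPartialSum]
    exact ⟨h0 ▸ MemLp.zero, by simp [h0]⟩
  | succ J ih =>
    obtain ⟨hJ, ih⟩ := ih
    have hs : schmidtPartialSum η u v (J + 1) =
        schmidtPartialSum η u v J + fun p => (η J : ℂ) * conj (u J p.1) * v J p.2 := by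
      funext p
      simp [schmidtPartialSum, Finset.sum_range_succ]
    refine ⟨hs ▸ hJ.add (hm J), ?_⟩
    rw [Finset.sum_range_succ, ← ih, ← MemLp.toLp_add]
    congr 1

theorem tendsto_eLpNorm_sub_iff {Γ : X × Θ → ℂ} (hΓ : MemLp Γ 2 (μ.prod ν))
    {g : ℕ → X × Θ → ℂ} (hg : ∀ J, MemLp (g J) 2 (μ.prod ν)) :
    Tendsto (fun J => eLpNorm (Γ - g J) 2 (μ.prod ν)) atTop (𝓝 0) ↔
      Tendsto (fun J => (hg J).toLp _) atTop (𝓝 (hΓ.toLp _)) := by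
  rw [tendsto_iff_edist_tendsto_0]
  refine tendsto_congr fun J => ?_
  rw [edist_comm, Lp.edist_toLp_toLp]

/-- Beyond `N` the functions `u j` and `v j` are arbitrary, perhaps not measurable, but `η j = 0`
makes the term zero everywhere; below `N` orthonormality carries over to the tensors. -/
theorem exists_memLp_term [SigmaFinite μ] [SigmaFinite ν]
    (h : IsSchmidtSystem μ ν N η u v) :
    ∃ hm : ∀ j, MemLp (fun p : X × Θ => (η j : ℂ) * conj (u j p.1) * v j p.2) 2 (μ.prod ν),
      ∀ i j, ⟪(hm i).toLp _, (hm j).toLp _⟫_ℂ = if i = j then ((η j : ℂ)) ^ 2 else 0 := by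
  obtain ⟨hu, hou⟩ := h.orthonormal_left
  obtain ⟨hv, hov⟩ := h.orthonormal_right
  have hz : ∀ j : ℕ, N ≤ (j : ℕ∞) →
      (fun p : X × Θ => (η j : ℂ) * conj (u j p.1) * v j p.2) = 0 := fun j hj => by
    funext p
    simp [h.eq_zero j hj]
  have hs : ∀ j : ℕ, (fun p : X × Θ => (η j : ℂ) * conj (u j p.1) * v j p.2) =
      (η j : ℂ) • fun p : X × Θ => conj (u j p.1) * v j p.2 := fun j => by
    funext p
    simp [mul_assoc]
  have hm : ∀ j, MemLp (fun p : X × Θ => (η j : ℂ) * conj (u j p.1) * v j p.2) 2 (μ.prod ν) := by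
    intro j
    rcases lt_or_ge (j : ℕ∞) N with hj | hj
    · rw [hs]
      exact (memLp_conj_mul (hu ⟨j, hj⟩) (hv ⟨j, hj⟩)).const_smul _
    · rw [hz j hj]
      exact MemLp.zero
  have hzero : ∀ j : ℕ, N ≤ (j : ℕ∞) → (hm j).toLp _ = 0 := fun j hj => by
    rw [MemLp.toLp_congr (hm j) MemLp.zero (by rw [hz j hj]), MemLp.toLp_zero]
  have hten : ∀ (j : ℕ) (hj : (j : ℕ∞) < N), (hm j).toLp _ =
      (η j : ℂ) • tensor ((hu ⟨j, hj⟩).toLp (u j)) ((hv ⟨j, hj⟩).toLp (v j)) := fun j hj => by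
    rw [tensor_toLp, ← MemLp.toLp_const_smul, MemLp.toLp_eq_toLp_iff, hs]
  refine ⟨hm, fun i j => ?_⟩
  rcases lt_or_ge (i : ℕ∞) N with hi | hi
  · rcases lt_or_ge (j : ℕ∞) N with hj | hj
    · rw [hten i hi, hten j hj, inner_smul_left, inner_smul_right, inner_tensor,
        orthonormal_iff_ite.1 hou ⟨j, hj⟩ ⟨i, hi⟩, orthonormal_iff_ite.1 hov ⟨i, hi⟩ ⟨j, hj⟩]
      by_cases hij : i = j
      · subst hij
        simp [pow_two]
      · simp [hij]
    · rw [hzero j hj, inner_zero_right, h.eq_zero j hj]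
      simp
  · rw [hzero i hi, inner_zero_left]
    split_ifs with hij
    · rw [← hij, h.eq_zero i hi]
      simp
    · rfl

end SchmidtExpansion

open SchmidtExpansion in
theorem mainTheorem3 {X Θ : Type*} [MeasurableSpace X] [MeasurableSpace Θ]
    (μ : Measure X) (ν : Measure Θ) [SigmaFinite μ] [SigmaFinite ν]
    (Γ : X × Θ → ℂ) (hΓ : MemLp Γ 2 (μ.prod ν)) :
    -- existence of an expansion, with systems as long as the two spaces allow
    (∃ (η : ℕ → ℝ) (u : ℕ → X → ℂ) (v : ℕ → Θ → ℂ),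
      IsSchmidtSystem μ ν (min (dimL2 μ) (dimL2 ν)) η u v ∧
      Tendsto (fun J => eLpNorm (Γ - schmidtPartialSum η u v J) 2 (μ.prod ν)) atTop (𝓝 0)) ∧
    -- properties of every such expansion
    (∀ (N : ℕ∞) (η : ℕ → ℝ) (u : ℕ → X → ℂ) (v : ℕ → Θ → ℂ),
      IsSchmidtSystem μ ν N η u v →
      Tendsto (fun J => eLpNorm (Γ - schmidtPartialSum η u v J) 2 (μ.prod ν)) atTop (𝓝 0) →
      (∀ J, IsFAS (schmidtPartialSum η u v J) ∧
        MemLp (schmidtPartialSum η u v J) 2 (μ.prod ν) ∧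
        (eLpNorm (Γ - schmidtPartialSum η u v J) 2 (μ.prod ν)).toReal ^ 2 =
          (eLpNorm Γ 2 (μ.prod ν)).toReal ^ 2 - ∑ j ∈ Finset.range J, η j ^ 2) ∧
      (Summable η →
        (∃ M : ℝ, ∀ j : ℕ, (j : ℕ∞) < N → (∀ x, ‖u j x‖ ≤ M) ∧ (∀ θ, ‖v j θ‖ ≤ M)) →
        (∀ p, Tendsto (fun J => schmidtPartialSum η u v J p) atTop (𝓝 (Γ p))) →
        TendstoUniformly (schmidtPartialSum η u v) Γ atTop)) := by
  constructor
  · obtain ⟨η, a, b, ha, hb, h0, hanti, hz, hlim⟩ :=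
      exists_schmidt_expansion (t := tensorL μ ν) inner_tensor eq_zero_of_inner_tensor_eq_zero
        (hΓ.toLp Γ) (N := min (dimL2 μ) (dimL2 ν)) rfl
    have hsys : IsSchmidtSystem μ ν (min (dimL2 μ) (dimL2 ν)) η (fun j => a j) (fun j => b j) :=
      ⟨⟨fun j => Lp.memLp (a j), by simpa only [Lp.toLp_coeFn] using ha⟩,
        ⟨fun j => Lp.memLp (b j), by simpa only [Lp.toLp_coeFn] using hb⟩, h0, hanti, hz⟩
    refine ⟨η, fun j => a j, fun j => b j, hsys, ?_⟩
    obtain ⟨hm, -⟩ := exists_memLp_term hsys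
    choose hJ hsum using toLp_schmidtPartialSum hm
    rw [tendsto_eLpNorm_sub_iff hΓ hJ]
    simp only [hsum]
    refine hlim.congr fun J => Finset.sum_congr rfl fun j _ => ?_
    rw [tensorL_apply, tensor, ← MemLp.toLp_const_smul, MemLp.toLp_eq_toLp_iff]
    refine Eventually.of_forall fun p => ?_
    simp [mul_assoc]
  · intro N η u v hsys hlim
    obtain ⟨hm, hinner⟩ := exists_memLp_term hsys
    choose hJ hsum using toLp_schmidtPartialSum hm
    rw [tendsto_eLpNorm_sub_iff hΓ hJ] at hlim
    simp only [hsum] at hlim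
    refine ⟨fun J => ⟨isFAS_schmidtPartialSum η u v J, hJ J, ?_⟩, fun hη ⟨M, hM⟩ hp =>
      tendstoUniformly_schmidtPartialSum hsys.nonneg hsys.eq_zero hη hM hp⟩
    have h := norm_sub_sum_sq hinner (inner_eq_of_tendsto_sum hinner hlim) J
    rwa [← hsum, ← MemLp.toLp_sub, Lp.norm_toLp, Lp.norm_toLp] at h
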